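/- Let $d\ge 4$ be a fixed integer. For $n=1,2,\ldots$ let $B_n$ be the grid graph with vertex set $V_n=\{-n,\ldots,n\}^d$, in which two vertices are adjacent when their $\ell^1$ distance is $1$, and let $P_n$ be the transition matrix on $V_n$ of the simple random walk with reflecting boundary: if $\|u-v\|_1=1$ and $i$ is the coordinate in which $u$ and $v$ differ, then $P_n(u,v)=\frac1{2d}$ when $|u_i|\ne n$ and $P_n(u,v)=\frac1d$ when $|u_i|=n$; all other entries are $0$. Let $\mathfrak d\colon\mathbb Z_{>0}\to\mathbb Z_{\ge 0}$ satisfy $\sum_{n\ge1}\mathfrak d(n)=\infty$ (so that the walk below is defined at all times), and put $T_n=\sum_{i=1}^n\mathfrak d(i)$, $T_0=0$. Let $(X_t)_{t\ge0}$ be the Markov chain with $X_0=\vec 0$ whose transition from $X_t$ to $X_{t+1}$ follows $P_n$ whenever $T_{n-1}\le t<T_n$; that is, the walk stays in the box $B_n$ for $\mathfrak d(n)$ steps before the box grows to $B_{n+1}$. Let $R(t)=\Pr[X_t=\vec 0]$. The origin is called recurrent if $\sum_{t=1}^\infty R(t)=\infty$, and transient if $\sum_{t=0}^\infty R(t)<\infty$.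 Then the origin is recurrent if and only if $$\sum_{n=1}^\infty\frac{\mathfrak d(n)}{n^d}=\infty ,$$ and it is transient if and only if this sum is finite. -/

import Mathlib

open scoped ENNReal NNReal

/-- A random walk on a growing graph, given by a triple `(𝔡, G, P)`: during phase `n = 1, 2, …`,
which lasts for `𝔡 n` time steps, the walk moves on the finite simple graph `G n` according to the
stochastic matrix `P n`. All the graphs are subgraphs of the complete graph on an ambient set `V`.
Only the entries `P n u v` with `u` a vertex of `G n` matter. -/
structure RWoGG (V : Type*) where
  /-- the duration of each phase; `0` is allowed -/
  duration : ℕ+ → ℕ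
  /-- the graph of each phase -/
  graph : ℕ+ → (⊤ : SimpleGraph V).Subgraph
  /-- the transition matrix of each phase -/
  P : ℕ+ → V → V → ℝ≥0
  finite_verts : ∀ n, (graph n).verts.Finite
  graph_mono : Monotone graph
  /-- the walk moves along the edges of the graph, or stays where it is -/
  P_support : ∀ n, ∀ u ∈ (graph n).verts, ∀ v, P n u v ≠ 0 → v = u ∨ (graph n).Adj u v
  /-- the matrix is stochastic (by `P_support`, the sum runs over vertices of `graph n`) -/
  P_stochastic : ∀ n, ∀ u ∈ (graph n).verts, HasSum (P n u) 1
  /-- every time `t = 0, 1, 2, …` belongs to some phase: `t < 𝔡 1 + ⋯ + 𝔡 n` for some `n` -/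
  duration_unbounded : ∀ t : ℕ, ∃ n : ℕ, t < ∑ i ∈ Finset.range n, duration i.succPNat

namespace RWoGG

variable {V : Type*} (D : RWoGG V)

/-- `T n = 𝔡 1 + ⋯ + 𝔡 n`, the time at which phase `n` ends; `T 0 = 0`. -/
def T (n : ℕ) : ℕ := ∑ i ∈ Finset.range n, D.duration i.succPNat

open Classical in
/-- For each time `t` there is a unique `k` with `T k ≤ t < T (k + 1)`; this is that `k`. -/
noncomputable def completedPhases (t : ℕ) : ℕ := Nat.find (D.duration_unbounded t) - 1

/-- The phase that governs the transition from time `t` to time `t + 1`, namely the unique `n ≥ 1`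
with `T (n - 1) ≤ t < T n`. -/
noncomputable def phase (t : ℕ) : ℕ+ := (D.completedPhases t).succPNat

theorem T_le_and_lt (t : ℕ) :
    D.T (D.completedPhases t) ≤ t ∧ t < D.T (D.completedPhases t + 1) := by
  classical
  have h := Nat.find_spec (D.duration_unbounded t)
  have h0 : Nat.find (D.duration_unbounded t) ≠ 0 := by
    intro h0
    rw [h0] at h
    simp at h
  constructor
  · by_contra hc
    have := Nat.find_min' (D.duration_unbounded t) (m := D.completedPhases t) (not_le.mp hc)
    unfold completedPhases at this
    omega
  · have e : D.completedPhases t + 1 = Nat.find (D.duration_unbounded t) := by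
      unfold completedPhases
      omega
    rw [e]
    exact h

open Classical in
/-- The distribution of the next position of the walk, when it is at `u` at time `t`. (The walk
never is outside the vertex set of the current graph; the value there is irrelevant.) -/
noncomputable def step (t : ℕ) (u : V) : PMF V :=
  if h : u ∈ (D.graph (D.phase t)).verts then
    ⟨fun v => (D.P (D.phase t) u v : ℝ≥0∞),
      by simpa using ENNReal.hasSum_coe.2 (D.P_stochastic (D.phase t) u h)⟩
  else PMF.pure u

variable [MeasurableSpace V] [DiscreteMeasurableSpace V]

/-- The transition of the Markov chain from time `t` to time `t + 1`, given the past `X₀, …, X_t`: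
it depends on `X_t` only. -/
noncomputable def kernel (t : ℕ) :
    ProbabilityTheory.Kernel ((i : Finset.Iic t) → (fun _ : ℕ => V) i) V where
  toFun x := (D.step t (x ⟨t, Finset.mem_Iic.2 le_rfl⟩)).toMeasure
  measurable' := (Measurable.of_discrete (f := fun u => (D.step t u).toMeasure)).comp
    (measurable_pi_apply _)

instance (t : ℕ) : ProbabilityTheory.IsMarkovKernel (D.kernel t) :=
  ⟨fun x => PMF.toMeasure.isProbabilityMeasure (D.step t (x ⟨t, Finset.mem_Iic.2 le_rfl⟩))⟩

/-- The law, on the space of trajectories `ℕ → V`, of the random walk `X₀, X₁, X₂, …` on the growing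
graph with `X₀ = v`. -/
noncomputable def pathMeasure (v : V) : MeasureTheory.Measure (ℕ → V) :=
  ProbabilityTheory.Kernel.trajMeasure (X := fun _ => V) (MeasureTheory.Measure.dirac v) D.kernel

/-- The return probability `R(t) = Pr[X_t = v]` of the walk with `X₀ = v`
(for `v` a vertex of the first graph). -/
noncomputable def returnProb (v : V) (t : ℕ) : ℝ≥0∞ := D.pathMeasure v {ω | ω t = v}

/-- `v` is recurrent if `∑_{t ≥ 1} R(t) = ∞`. -/
def IsRecurrent (v : V) : Prop := ∑' t : ℕ, D.returnProb v (t + 1) = ∞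

/-- `v` is transient if `∑_{t ≥ 0} R(t)` is finite. -/
def IsTransient (v : V) : Prop := ∑' t : ℕ, D.returnProb v t < ∞

end RWoGG

/-- The `ℓ¹` distance on `ℤ^d`. -/
def l1Dist {d : ℕ} (u v : Fin d → ℤ) : ℤ := ∑ i, |u i - v i|

/-- The grid graph on the box `{-n, …, n}^d`, two points being adjacent when their `ℓ¹` distance
is `1`. -/
def boxGraph (d : ℕ) (n : ℕ+) : (⊤ : SimpleGraph (Fin d → ℤ)).Subgraph where
  verts := {u | ∀ i, |u i| ≤ (n : ℤ)}
  Adj u v := (∀ i, |u i| ≤ (n : ℤ)) ∧ (∀ i, |v i| ≤ (n : ℤ)) ∧ l1Dist u v = 1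
  adj_sub := by
    rintro u v ⟨-, -, h⟩
    rw [SimpleGraph.top_adj]
    rintro rfl
    simp [l1Dist] at h
  edge_vert h := h.1
  symm := ⟨by
    rintro u v ⟨hu, hv, h⟩
    refine ⟨hv, hu, ?_⟩
    simpa [l1Dist, abs_sub_comm] using h⟩

open Classical in
/-- The transition matrix of the simple random walk on the box `{-n, …, n}^d` with reflecting
boundary. For `u`, `v` at `ℓ¹` distance `1`, let `i` be the coordinate in which they differ; then
the entry is `1 / d` if `|u i| = n`, and `1 / (2 d)` otherwise. -/
noncomputable def boxP (d : ℕ) (n : ℕ+) (u v : Fin d → ℤ) : ℝ≥0 :=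
  if (boxGraph d n).Adj u v then
    if ∃ i, u i ≠ v i ∧ |u i| = (n : ℤ) then 1 / (d : ℝ≥0) else 1 / (2 * (d : ℝ≥0))
  else 0

theorem l1Dist_update {d : ℕ} (u : Fin d → ℤ) (i : Fin d) (a : ℤ) :
    l1Dist u (Function.update u i (u i + a)) = |a| := by
  unfold l1Dist
  rw [Finset.sum_eq_single i]
  · simp
  · intro j _ hj
    simp [Function.update_of_ne hj]
  · simp

/-- The points at `ℓ¹` distance `1` from `u` arise by adding `±1` to one coordinate. -/
theorem exists_update_of_l1Dist_eq_one {d : ℕ} {u v : Fin d → ℤ} (h : l1Dist u v = 1) :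
    ∃ (i : Fin d) (s : ℤˣ), Function.update u i (u i + s) = v := by
  unfold l1Dist at h
  obtain ⟨i, -, hi⟩ : ∃ i ∈ Finset.univ, |u i - v i| ≠ 0 :=
    Finset.exists_ne_zero_of_sum_ne_zero (by rw [h]; exact one_ne_zero)
  have hsplit := Finset.add_sum_erase Finset.univ (fun j => |u j - v j|) (Finset.mem_univ i)
  have hnn : 0 ≤ ∑ j ∈ Finset.univ.erase i, |u j - v j| :=
    Finset.sum_nonneg fun j _ => abs_nonneg _
  have hpos : 0 < |u i - v i| := lt_of_le_of_ne (abs_nonneg _) (Ne.symm hi)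
  have h1 : |v i - u i| = 1 := by
    rw [abs_sub_comm]
    omega
  have h0 : ∑ j ∈ Finset.univ.erase i, |u j - v j| = 0 := by
    omega
  have hz := (Finset.sum_eq_zero_iff_of_nonneg fun j _ => abs_nonneg _).1 h0
  refine ⟨i, (Int.isUnit_iff_abs_eq.2 h1).unit, ?_⟩
  funext j
  by_cases hj : j = i
  · subst hj
    simp
  · have := hz j (by simp [hj])
    rw [Function.update_of_ne hj]
    rw [abs_eq_zero] at this
    omega

theorem boxGraph_adj_update {d : ℕ} {n : ℕ+} {u : Fin d → ℤ} (hu : u ∈ (boxGraph d n).verts)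
    (i : Fin d) (s : ℤˣ) :
    (boxGraph d n).Adj u (Function.update u i (u i + s)) ↔ |u i + s| ≤ (n : ℤ) := by
  constructor
  · rintro ⟨-, h, -⟩
    simpa using h i
  · intro h
    refine ⟨hu, fun j => ?_, ?_⟩
    · by_cases hj : j = i
      · subst hj
        simpa using h
      · rw [Function.update_of_ne hj]
        exact hu j
    · rw [l1Dist_update]
      exact Int.isUnit_iff_abs_eq.1 s.isUnit

theorem boxP_update {d : ℕ} {n : ℕ+} {u : Fin d → ℤ} (hu : u ∈ (boxGraph d n).verts)
    (i : Fin d) (s : ℤˣ) :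
    boxP d n u (Function.update u i (u i + s)) =
      if |u i + s| ≤ (n : ℤ) then
        if |u i| = (n : ℤ) then 1 / (d : ℝ≥0) else 1 / (2 * (d : ℝ≥0))
      else 0 := by
  have key : (∃ j, u j ≠ Function.update u i (u i + s) j ∧ |u j| = (n : ℤ)) ↔
      |u i| = (n : ℤ) := by
    constructor
    · rintro ⟨j, hj, h⟩
      by_cases hji : j = i
      · exact hji ▸ h
      · exact absurd (Function.update_of_ne hji _ _).symm hj
    · intro h
      exact ⟨i, by simp, h⟩
  unfold boxP
  simp only [boxGraph_adj_update hu, key]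

theorem boxP_stochastic {d : ℕ} (hd : 0 < d) (n : ℕ+) (u : Fin d → ℤ)
    (hu : u ∈ (boxGraph d n).verts) : HasSum (boxP d n u) 1 := by
  let g : Fin d × ℤˣ → (Fin d → ℤ) := fun p => Function.update u p.1 (u p.1 + p.2)
  have hg : Function.Injective g := by
    rintro ⟨i, s⟩ ⟨j, r⟩ h
    have hij : i = j := by
      by_contra hne
      have := congrFun h i
      simp [g, Function.update_of_ne hne] at this
    subst hij
    have := congrFun h i
    simp only [g, Function.update_self, add_right_inj, Units.val_inj] at this
    rw [this]
  have hsupp : ∀ v ∉ Set.range g, boxP d n u v = 0 := by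
    intro v hv
    unfold boxP
    rw [if_neg]
    rintro ⟨-, -, h⟩
    obtain ⟨i, s, h⟩ := exists_update_of_l1Dist_eq_one h
    exact hv ⟨(i, s), h⟩
  rw [← hg.hasSum_iff hsupp]
  have hn : (1 : ℤ) ≤ n := by exact_mod_cast Order.one_le_iff_pos.2 n.pos
  have hd' : (d : ℝ≥0) ≠ 0 := by exact_mod_cast hd.ne'
  have hsum : ∑ p, (boxP d n u ∘ g) p = 1 := by
    rw [Fintype.sum_prod_type]
    have hrow : ∀ i : Fin d, ∑ s : ℤˣ, (boxP d n u ∘ g) (i, s) = 1 / (d : ℝ≥0) := by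
      intro i
      have hui : |u i| ≤ (n : ℤ) := hu i
      have hhalf : 1 / (2 * (d : ℝ≥0)) + 1 / (2 * (d : ℝ≥0)) = 1 / (d : ℝ≥0) := by
        field_simp
        norm_num
      rw [UnitsInt.univ, Finset.sum_pair (by decide)]
      have e1 : (boxP d n u ∘ g) (i, 1) = _ := boxP_update hu i 1
      have e2 : (boxP d n u ∘ g) (i, -1) = _ := boxP_update hu i (-1)
      rw [e1, e2, Units.val_neg, Units.val_one]
      by_cases hb : |u i| = (n : ℤ)
      · rw [if_pos hb]
        rcases abs_eq (by omega) |>.1 hb with h | h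
        · rw [if_neg, if_pos, zero_add] <;> rw [h, abs_le] <;> omega
        · rw [if_pos, if_neg, add_zero] <;> rw [h, abs_le] <;> omega
      · have hlt : |u i| < (n : ℤ) := lt_of_le_of_ne hui hb
        rw [abs_lt] at hlt
        rw [if_neg hb]
        rw [if_pos, if_pos, hhalf] <;> rw [abs_le] <;> omega
    simp only [hrow, Finset.sum_const, Finset.card_univ, Fintype.card_fin, nsmul_eq_mul]
    field_simp
  exact hsum ▸ hasSum_fintype _

/-- The simple random walk with reflecting boundary on the growing box `{-n, …, n}^d`, where phase
`n` lasts for `𝔡 n` steps. -/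
noncomputable def boxRWoGG (d : ℕ) (hd : 0 < d) (𝔡 : ℕ+ → ℕ)
    (h𝔡 : ∀ t : ℕ, ∃ n : ℕ, t < ∑ i ∈ Finset.range n, 𝔡 i.succPNat) : RWoGG (Fin d → ℤ) where
  duration := 𝔡
  graph := boxGraph d
  P := boxP d
  finite_verts n := by
    refine (Set.finite_Icc (fun _ : Fin d => -(n : ℤ)) (fun _ => (n : ℤ))).subset fun u hu => ?_
    exact ⟨fun i => (abs_le.1 (hu i)).1, fun i => (abs_le.1 (hu i)).2⟩
  graph_mono n m h := by
    have h' : (n : ℤ) ≤ m := by exact_mod_cast h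
    exact ⟨fun u hu i => (hu i).trans h',
      fun u v huv => ⟨fun i => (huv.1 i).trans h', fun i => (huv.2.1 i).trans h', huv.2.2⟩⟩
  P_support n u _ v h := by
    right
    by_contra hc
    exact h (if_neg hc)
  P_stochastic n u hu := boxP_stochastic hd n u hu
  duration_unbounded := h𝔡

namespace RWoGG

open MeasureTheory ProbabilityTheory

variable {V : Type*} (D : RWoGG V)

theorem step_apply {t : ℕ} {u : V} (h : u ∈ (D.graph (D.phase t)).verts) (w : V) :
    D.step t u w = (D.P (D.phase t) u w : ℝ≥0∞) := by
  have e : D.step t u = _ := dif_pos h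
  rw [e]
  rfl

theorem T_mono : Monotone D.T := fun _ _ h =>
  Finset.sum_le_sum_of_subset (Finset.range_mono h)

theorem completedPhases_eq_iff (t n : ℕ) :
    D.completedPhases t = n ↔ t ∈ Finset.Ico (D.T n) (D.T (n + 1)) := by
  have h := D.T_le_and_lt t
  rw [Finset.mem_Ico]
  refine ⟨fun e => e ▸ h, fun e => ?_⟩
  by_contra hne
  rcases lt_or_gt_of_ne hne with hlt | hlt
  · have := D.T_mono (Nat.succ_le_of_lt hlt)
    simp only [Nat.succ_eq_add_one] at this
    omega
  · have := D.T_mono (Nat.succ_le_of_lt hlt)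
    simp only [Nat.succ_eq_add_one] at this
    omega

theorem completedPhases_mono : Monotone D.completedPhases := by
  intro s t hst
  by_contra hlt
  have h1 := D.T_le_and_lt s
  have h2 := D.T_le_and_lt t
  have := D.T_mono (Nat.succ_le_of_lt (not_le.1 hlt))
  simp only [Nat.succ_eq_add_one] at this
  omega

theorem phase_mono : Monotone D.phase := fun _ _ h =>
  Nat.succPNat_mono (D.completedPhases_mono h)

theorem tsum_phase (f : ℕ+ → ℝ≥0∞) :
    ∑' t, f (D.phase t) = ∑' n, (D.duration n : ℝ≥0∞) * f n := by
  rw [← Equiv.pnatEquivNat.symm.tsum_eq (fun n => (D.duration n : ℝ≥0∞) * f n),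
    ← (Equiv.sigmaFiberEquiv D.completedPhases).tsum_eq, ENNReal.tsum_sigma']
  refine tsum_congr fun n => ?_
  have h1 : ∀ b : {t // D.completedPhases t = n},
      f (D.phase ((Equiv.sigmaFiberEquiv D.completedPhases) ⟨n, b⟩)) = f n.succPNat := by
    rintro ⟨t, rfl⟩
    rfl
  simp only [h1, ENNReal.tsum_const]
  have h2 : {t | D.completedPhases t = n} = ↑(Finset.Ico (D.T n) (D.T (n + 1))) := by
    ext t
    exact D.completedPhases_eq_iff t n
  have h3 : ENat.card {t // D.completedPhases t = n} = (D.duration n.succPNat : ℕ∞) := by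
    change Set.encard {t | D.completedPhases t = n} = _
    rw [h2, Set.encard_coe_eq_coe_finsetCard, Nat.card_Ico, T, T, Finset.sum_range_succ,
      Nat.add_sub_cancel_left]
  rw [h3]
  rfl

variable [MeasurableSpace V] [DiscreteMeasurableSpace V]

instance (v : V) : IsProbabilityMeasure (D.pathMeasure v) := by
  unfold pathMeasure
  infer_instance

theorem lintegral_pathMeasure_zero (v : V) (f : V → ℝ≥0∞) :
    ∫⁻ ω, f (ω 0) ∂D.pathMeasure v = f v := by
  have hf : Measurable f := Measurable.of_discrete
  have hm : Measurable fun x : Finset.Iic 0 → V => f (x ⟨0, Finset.mem_Iic.2 le_rfl⟩) :=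
    hf.comp (measurable_pi_apply _)
  have key : (D.pathMeasure v).map (Preorder.frestrictLe 0) =
      (Measure.dirac v).map (MeasurableEquiv.piUnique
        (fun _ : Finset.Iic 0 => V)).symm := by
    unfold pathMeasure Kernel.trajMeasure
    rw [Measure.map_comp _ _ (by fun_prop), Kernel.traj_map_frestrictLe,
      Kernel.partialTraj_self, Measure.id_comp]
  have h1 : ∫⁻ ω, f (ω 0) ∂D.pathMeasure v =
      ∫⁻ x, f (x ⟨0, Finset.mem_Iic.2 le_rfl⟩)
        ∂(D.pathMeasure v).map (Preorder.frestrictLe 0) := by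
    rw [lintegral_map hm (by fun_prop)]
    rfl
  rw [h1, key, lintegral_map hm (by fun_prop),
    lintegral_dirac' _ (Measurable.of_discrete)]
  rfl

theorem lintegral_pathMeasure_succ [Countable V] (v : V) (t : ℕ) (f : V → ℝ≥0∞) :
    ∫⁻ ω, f (ω (t + 1)) ∂D.pathMeasure v =
      ∫⁻ ω, ∑' w, D.step t (ω t) w * f w ∂D.pathMeasure v := by
  have hf : Measurable f := Measurable.of_discrete
  have hm : Measurable fun q : (Finset.Iic t → V) × V => f q.2 := hf.comp measurable_snd
  have key := Kernel.map_frestrictLe_trajMeasure_compProd_eq_map_trajMeasure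
    (X := fun _ => V) (μ₀ := Measure.dirac v) (κ := D.kernel) (a := t)
  have h1 : ∫⁻ ω, f (ω (t + 1)) ∂D.pathMeasure v = ∫⁻ q, f q.2
      ∂(D.pathMeasure v).map (fun x => (Preorder.frestrictLe t x, x (t + 1))) := by
    rw [lintegral_map hm (by fun_prop)]
  rw [h1, pathMeasure, ← key, Measure.lintegral_compProd hm, lintegral_map]
  · refine lintegral_congr fun ω => ?_
    change ∫⁻ w, f w ∂(D.step t (ω t)).toMeasure = _
    rw [lintegral_countable']
    refine tsum_congr fun w => ?_
    rw [PMF.toMeasure_apply_singleton _ _ (measurableSet_singleton _), mul_comm]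
  · exact Measurable.lintegral_kernel_prod_right' hm
  · fun_prop

/-- If `h s` is the probability, as a function of the position at time `s`, of being at `v` at
time `t`, then `h 0 v` is the return probability. -/
theorem returnProb_eq [Countable V] (v : V) (t : ℕ) (h : ℕ → V → ℝ≥0∞)
    (ht : ∀ u, h t u = Set.indicator {v} 1 u)
    (hs : ∀ s < t, ∀ u, h s u = ∑' w, D.step s u w * h (s + 1) w) :
    D.returnProb v t = h 0 v := by
  have key : ∀ k ≤ t, ∫⁻ ω, h k (ω k) ∂D.pathMeasure v = h 0 v := by
    intro k
    induction k with
    | zero => intro _; exact D.lintegral_pathMeasure_zero v _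
    | succ k ih =>
      intro hk
      rw [D.lintegral_pathMeasure_succ, ← ih (by omega)]
      exact lintegral_congr fun ω => (hs k (by omega) _).symm
  rw [← key t le_rfl]
  have : (fun ω : ℕ → V => h t (ω t)) = Set.indicator {ω : ℕ → V | ω t = v} 1 := by
    funext ω
    rw [ht]
    rfl
  rw [this, lintegral_indicator_one]
  · rfl
  · exact (measurable_pi_apply (X := fun _ : ℕ => V) t) (measurableSet_singleton v)

end RWoGG

/-- The points of the box `{-n, …, n}^d`. -/
def InBox {d : ℕ} (n : ℕ) (x : Fin d → ℤ) : Prop := ∀ i, |x i| ≤ (n : ℤ)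

theorem InBox.mono {d : ℕ} {m n : ℕ} (h : m ≤ n) {x : Fin d → ℤ} (hx : InBox m x) : InBox n x :=
  fun i => (hx i).trans (by exact_mod_cast h)

theorem InBox.update {d : ℕ} {n : ℕ} {x : Fin d → ℤ} (hx : InBox n x) (i : Fin d) {a : ℤ}
    (ha : |a| ≤ n) : InBox n (Function.update x i a) := by
  intro j
  by_cases hj : j = i
  · subst hj; simpa using ha
  · rw [Function.update_of_ne hj]; exact hx j

/-- The step to the right of the reflected walk on `{-n, …, n}`. -/
def stepUp (n : ℕ) (a : ℤ) : ℤ := if a + 1 ≤ n then a + 1 else a - 1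

/-- The step to the left of the reflected walk on `{-n, …, n}`. -/
def stepDown (n : ℕ) (a : ℤ) : ℤ := if -(n : ℤ) ≤ a - 1 then a - 1 else a + 1

theorem abs_stepUp_le {n : ℕ} (hn : 1 ≤ n) {a : ℤ} (ha : |a| ≤ n) : |stepUp n a| ≤ n := by
  unfold stepUp
  rw [abs_le] at *
  split_ifs <;> omega

theorem abs_stepDown_le {n : ℕ} (hn : 1 ≤ n) {a : ℤ} (ha : |a| ≤ n) : |stepDown n a| ≤ n := by
  unfold stepDown
  rw [abs_le] at *
  split_ifs <;> omega

/-- The reflected average of `f` along coordinate `i`. -/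
def coordSum {R : Type*} [Add R] {d : ℕ} (n : ℕ) (i : Fin d) (f : (Fin d → ℤ) → R)
    (x : Fin d → ℤ) : R :=
  f (Function.update x i (stepUp n (x i))) + f (Function.update x i (stepDown n (x i)))

/-- The transition operator of the reflected walk on the box, acting on functions. -/
noncomputable def avgStep {d : ℕ} (n : ℕ) (f : (Fin d → ℤ) → ℝ≥0) (x : Fin d → ℤ) : ℝ≥0 :=
  1 / (2 * (d : ℝ≥0)) * ∑ i, coordSum n i f x

theorem avgStep_mono {d n : ℕ} (hn : 1 ≤ n) {f g : (Fin d → ℤ) → ℝ≥0}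
    (h : ∀ x, InBox n x → f x ≤ g x) {x : Fin d → ℤ} (hx : InBox n x) :
    avgStep n f x ≤ avgStep n g x := by
  unfold avgStep coordSum
  gcongr with i
  · exact h _ (hx.update i (abs_stepUp_le hn (hx i)))
  · exact h _ (hx.update i (abs_stepDown_le hn (hx i)))

theorem avgStep_const {d n : ℕ} (hd : 0 < d) (c : ℝ≥0) (x : Fin d → ℤ) :
    avgStep n (fun _ => c) x = c := by
  have : (d : ℝ≥0) ≠ 0 := by exact_mod_cast hd.ne'
  simp only [avgStep, coordSum, Finset.sum_const, Finset.card_univ, Fintype.card_fin, nsmul_eq_mul]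
  field_simp
  ring

/-- Functions on the box that are even in each coordinate and, along each coordinate axis,
nonincreasing away from `0` in steps of length `2`. -/
structure CoordUnimodal {d : ℕ} (n : ℕ) (f : (Fin d → ℤ) → ℝ≥0) : Prop where
  even : ∀ x, InBox n x → ∀ i, f (Function.update x i (-x i)) = f x
  anti : ∀ x, InBox n x → ∀ i, 0 ≤ x i → x i + 2 ≤ n → f (Function.update x i (x i + 2)) ≤ f x

namespace CoordUnimodal

variable {d n : ℕ} {f : (Fin d → ℤ) → ℝ≥0}

theorem mono {m : ℕ} (h : m ≤ n) (hf : CoordUnimodal n f) : CoordUnimodal m f :=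
  ⟨fun x hx => hf.even x (hx.mono h), fun x hx i h0 h2 => hf.anti x (hx.mono h) i h0 (by omega)⟩

theorem apply_neg (hf : CoordUnimodal n f) {x : Fin d → ℤ} (hx : InBox n x) (i : Fin d) {a : ℤ}
    (ha : |a| ≤ n) : f (Function.update x i (-a)) = f (Function.update x i a) := by
  simpa using hf.even _ (hx.update i ha) i

theorem apply_add_two_le (hf : CoordUnimodal n f) {x : Fin d → ℤ} (hx : InBox n x) (i : Fin d)
    {a : ℤ} (ha : -1 ≤ a) (ha' : a + 2 ≤ n) :
    f (Function.update x i (a + 2)) ≤ f (Function.update x i a) := by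
  rcases eq_or_lt_of_le ha with h | h
  · subst h
    have := hf.apply_neg hx i (a := 1) (by rw [abs_le]; omega)
    rw [this]
    norm_num
  · simpa using hf.anti _ (hx.update i (a := a) (by rw [abs_le]; omega)) i (by simp; omega)
      (by simpa using ha')

theorem avgStep (hn : 1 ≤ n) (hf : CoordUnimodal n f) : CoordUnimodal n (avgStep n f) := by
  constructor
  · intro x hx i
    unfold _root_.avgStep
    congr 1
    refine Finset.sum_congr rfl fun j _ => ?_
    unfold coordSum
    by_cases hj : j = i
    · subst hj
      have h1 : stepUp n (-x j) = -stepDown n (x j) := by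
        unfold stepUp stepDown; split_ifs <;> omega
      have h2 : stepDown n (-x j) = -stepUp n (x j) := by
        unfold stepUp stepDown; split_ifs <;> omega
      simp only [Function.update_self, Function.update_idem, h1, h2]
      rw [hf.apply_neg hx j (abs_stepDown_le hn (hx j)),
        hf.apply_neg hx j (abs_stepUp_le hn (hx j)), add_comm]
    · have key : ∀ a : ℤ, |a| ≤ n → f (Function.update (Function.update x i (-x i)) j a) =
          f (Function.update x j a) := by
        intro a ha
        have := hf.even _ (hx.update j ha) i
        rwa [Function.update_of_ne (Ne.symm hj), Function.update_comm hj] at this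
      rw [Function.update_of_ne hj, key _ (abs_stepUp_le hn (hx j)),
        key _ (abs_stepDown_le hn (hx j))]
  · intro x hx i h0 h2
    unfold _root_.avgStep
    gcongr with j
    unfold coordSum
    by_cases hj : j = i
    · subst hj
      simp only [Function.update_self, Function.update_idem]
      have e1 : stepUp n (x j) = x j + 1 := by unfold stepUp; rw [if_pos (by omega)]
      have e2 : stepDown n (x j) = x j - 1 := by unfold stepDown; rw [if_pos (by omega)]
      have e3 : stepDown n (x j + 2) = x j + 1 := by
        unfold stepDown; rw [if_pos (by omega)]; omega
      have k := hf.apply_add_two_le hx j (a := x j - 1) (by omega) (by omega)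
      rw [show x j - 1 + 2 = x j + 1 by omega] at k
      rw [e1, e2, e3]
      refine add_le_add ?_ k
      unfold stepUp
      split_ifs with h
      · have := hf.apply_add_two_le hx j (a := x j + 1) (by omega) (by omega)
        rwa [show x j + 1 + 2 = x j + 2 + 1 by omega] at this
      · rw [show x j + 2 - 1 = x j + 1 by omega]
    · have key : ∀ a : ℤ, |a| ≤ n → f (Function.update (Function.update x i (x i + 2)) j a) ≤
          f (Function.update x j a) := by
        intro a ha
        have := hf.anti _ (hx.update j ha) i
        rw [Function.update_of_ne (Ne.symm hj), Function.update_comm hj] at this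
        exact this h0 h2
      rw [Function.update_of_ne hj]
      exact add_le_add (key _ (abs_stepUp_le hn (hx j))) (key _ (abs_stepDown_le hn (hx j)))

theorem avgStep_le_avgStep {m : ℕ} (hm : 1 ≤ m) (hmn : m ≤ n) (hf : CoordUnimodal n f)
    {x : Fin d → ℤ} (hx : InBox m x) : _root_.avgStep n f x ≤ _root_.avgStep m f x := by
  unfold _root_.avgStep coordSum
  have hx' := hx.mono hmn
  gcongr with i
  · have hi := abs_le.1 (hx i)
    unfold stepUp
    split_ifs with h1 h2 h2
    · exact le_rfl
    · have := hf.apply_add_two_le hx' i (a := x i - 1) (by omega) (by omega)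
      rwa [show x i - 1 + 2 = x i + 1 by omega] at this
    · omega
    · exact le_rfl
  · have hi := abs_le.1 (hx i)
    unfold stepDown
    split_ifs with h1 h2 h2
    · exact le_rfl
    · have := hf.apply_add_two_le hx' i (a := -x i - 1) (by omega) (by omega)
      rw [show -x i - 1 + 2 = -(x i - 1) by omega, show -x i - 1 = -(x i + 1) by omega,
        hf.apply_neg hx' i (by rw [abs_le]; omega), hf.apply_neg hx' i (by rw [abs_le]; omega)]
        at this
      exact this
    · omega
    · exact le_rfl

/-- A coordinatewise unimodal function is bounded by its values on `{0, 1}^d`. -/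
theorem exists_le_apply (hf : CoordUnimodal n f) {x : Fin d → ℤ} (hx : InBox n x) :
    ∃ y : Fin d → ℤ, InBox 1 y ∧ f x ≤ f y := by
  induction hk : ∑ i, (4 * x i - 1).natAbs using Nat.strong_induction_on generalizing x with
  | _ k ih =>
    subst hk
    by_cases h : ∀ i, x i = 0 ∨ x i = 1
    · refine ⟨x, fun i => ?_, le_rfl⟩
      rcases h i with h | h <;> simp [h]
    · push Not at h
      obtain ⟨i, h0, h1⟩ := h
      have hi := abs_le.1 (hx i)
      have key : ∀ a : ℤ, |a| ≤ n → (4 * a - 1).natAbs < (4 * x i - 1).natAbs →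
          f x ≤ f (Function.update x i a) → ∃ y : Fin d → ℤ, InBox 1 y ∧ f x ≤ f y := by
        intro a ha hlt hle
        have hsum : ∑ j, (4 * Function.update x i a j - 1).natAbs <
            ∑ j, (4 * x j - 1).natAbs := by
          refine Finset.sum_lt_sum (fun j _ => ?_) ⟨i, Finset.mem_univ i, by simpa using hlt⟩
          by_cases hj : j = i
          · subst hj; simpa using hlt.le
          · rw [Function.update_of_ne hj]
        obtain ⟨y, hy, hxy⟩ := ih _ hsum (hx.update i ha) rfl
        exact ⟨y, hy, hle.trans hxy⟩
      rcases lt_or_ge (x i) 0 with hneg | hpos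
      · exact key (-x i) (by rw [abs_le]; omega) (by omega) (hf.even x hx i).ge
      · refine key (x i - 2) (by rw [abs_le]; omega) (by omega) ?_
        have := hf.apply_add_two_le hx i (a := x i - 2) (by omega) (by omega)
        simpa using this

end CoordUnimodal

/-- The probability that the reflected walk in the boxes of sizes `p s, p (s + 1), …` that starts
in `x` at time `s` is at the origin `k` steps later. -/
noncomputable def hitProb {d : ℕ} (p : ℕ → ℕ) : ℕ → ℕ → (Fin d → ℤ) → ℝ≥0
  | _, 0 => Pi.single 0 1
  | s, k + 1 => avgStep (p s) (hitProb p (s + 1) k)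

section hitProb

variable {d : ℕ} {p : ℕ → ℕ}

theorem hitProb_unimodal (hp : Monotone p) (h1 : ∀ s, 1 ≤ p s) (s k : ℕ) :
    CoordUnimodal (p s) (hitProb (d := d) p s k) := by
  induction k generalizing s with
  | zero =>
    constructor
    · intro x _ i
      simp only [hitProb, Pi.single_apply]
      congr 1
      rw [eq_iff_iff]
      constructor
      · intro h
        funext j
        have := congrFun h j
        by_cases hj : j = i
        · subst hj; simpa using this
        · rwa [Function.update_of_ne hj] at this
      · rintro rfl
        simp
    · intro x _ i h0 _
      simp only [hitProb, Pi.single_apply]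
      rw [if_neg]
      · exact zero_le
      · intro h
        have := congrFun h i
        simp at this
        omega
  | succ k ih => exact ((ih (s + 1)).mono (hp (Nat.le_succ s))).avgStep (h1 s)

theorem hitProb_const_le {n : ℕ} (hp : Monotone p) (h1 : ∀ s, 1 ≤ p s) (k s : ℕ)
    (hn : ∀ j < k, p (s + j) ≤ n) {x : Fin d → ℤ} (hx : InBox (p s) x) (r : ℕ) :
    hitProb (fun _ => n) r k x ≤ hitProb p s k x := by
  induction k generalizing s x r with
  | zero => exact le_rfl
  | succ k ih =>
    have hsn : p s ≤ n := hn 0 (by omega)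
    have hu := hitProb_unimodal (d := d) (p := fun _ => n) monotone_const
      (fun _ => (h1 s).trans hsn) (r + 1) k
    refine (hu.avgStep_le_avgStep (h1 s) hsn hx).trans (avgStep_mono (h1 s) (fun y hy => ?_) hx)
    refine ih (s + 1) (fun j hj => ?_) (hy.mono (hp (Nat.le_succ s))) (r + 1)
    have := hn (j + 1) (by omega)
    rwa [show s + (j + 1) = s + 1 + j by omega] at this

theorem hitProb_le_const {m : ℕ} (hm : 1 ≤ m) (hp : Monotone p) (h1 : ∀ s, 1 ≤ p s) (k s : ℕ)
    (hms : m ≤ p s) {x : Fin d → ℤ} (hx : InBox m x) (r : ℕ) :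
    hitProb p s k x ≤ hitProb (fun _ => m) r k x := by
  induction k generalizing s x r with
  | zero => exact le_rfl
  | succ k ih =>
    have hu := (hitProb_unimodal (d := d) hp h1 (s + 1) k).mono (hp (Nat.le_succ s))
    exact (hu.avgStep_le_avgStep hm hms hx).trans (avgStep_mono hm
      (fun y hy => ih (s + 1) (hms.trans (hp (Nat.le_succ s))) hy (r + 1)) hx)

theorem hitProb_le_of_forall (hd : 0 < d) (hp : Monotone p) (h1 : ∀ s, 1 ≤ p s) {c : ℝ≥0} {k : ℕ}
    (j s : ℕ) (hc : ∀ x, InBox (p (s + j)) x → hitProb (d := d) p (s + j) k x ≤ c)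
    {x : Fin d → ℤ} (hx : InBox (p s) x) : hitProb p s (j + k) x ≤ c := by
  induction j generalizing s x with
  | zero => simpa using hc x (by simpa using hx)
  | succ j ih =>
    rw [show j + 1 + k = (j + k) + 1 by omega, hitProb]
    refine (avgStep_mono (h1 s) (g := fun _ => c) (fun y hy => ?_) hx).trans
      (avgStep_const hd c x).le
    refine ih (s + 1) (fun z hz => ?_) (hy.mono (hp (Nat.le_succ s)))
    rw [show s + 1 + j = s + (j + 1) by omega] at *
    exact hc z hz

end hitProb

theorem tsum_boxP_mul {d : ℕ} {n : ℕ+} {u : Fin d → ℤ} (hu : InBox n u)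
    (f : (Fin d → ℤ) → ℝ≥0) :
    ∑' v, (boxP d n u v : ℝ≥0∞) * f v = avgStep n f u := by
  let g : Fin d × ℤˣ → (Fin d → ℤ) := fun q => Function.update u q.1 (u q.1 + q.2)
  have hg : Function.Injective g := by
    rintro ⟨i, s⟩ ⟨j, r⟩ h
    have hij : i = j := by
      by_contra hne
      have := congrFun h i
      simp [g, Function.update_of_ne hne] at this
    subst hij
    have := congrFun h i
    simp only [g, Function.update_self, add_right_inj, Units.val_inj] at this
    rw [this]
  have hsupp : Function.support (fun v => (boxP d n u v : ℝ≥0∞) * f v) ⊆ Set.range g := by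
    intro v hv
    by_contra hr
    apply hv
    have : boxP d n u v = 0 := by
      unfold boxP
      rw [if_neg]
      rintro ⟨-, -, h⟩
      obtain ⟨i, s, h⟩ := exists_update_of_l1Dist_eq_one h
      exact hr ⟨(i, s), h⟩
    simp [this]
  rw [← hg.tsum_eq hsupp, tsum_fintype, Fintype.sum_prod_type]
  unfold avgStep coordSum
  rw [Finset.mul_sum]
  rw [ENNReal.ofNNReal_finsetSum]
  refine Finset.sum_congr rfl fun i _ => ?_
  have hn : (1 : ℤ) ≤ n := by exact_mod_cast Order.one_le_iff_pos.2 n.pos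
  have hui := abs_le.1 (hu i)
  have half : 1 / (d : ℝ≥0) = 1 / (2 * (d : ℝ≥0)) + 1 / (2 * (d : ℝ≥0)) := by
    rw [one_div, one_div, mul_inv, ← add_mul]
    norm_num
  rw [UnitsInt.univ, Finset.sum_pair (by decide)]
  have e1 : boxP d n u (g (i, 1)) = _ := boxP_update hu i 1
  have e2 : boxP d n u (g (i, -1)) = _ := boxP_update hu i (-1)
  rw [e1, e2]
  simp only [g, Units.val_neg, Units.val_one]
  simp only [← ENNReal.coe_mul, ← ENNReal.coe_add, ENNReal.coe_inj]
  unfold stepUp stepDown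
  simp only [half, ← sub_eq_add_neg, abs_le, abs_eq (show (0 : ℤ) ≤ ((n : ℕ) : ℤ) by omega)]
  by_cases h1 : u i = n
  · rw [if_neg (by omega), if_pos (by omega), if_pos (by omega), if_neg (by omega),
      if_pos (by omega)]
    ring
  · by_cases h2 : u i = -n
    · rw [if_pos (by omega), if_pos (by omega), if_neg (by omega), if_pos (by omega),
        if_neg (by omega)]
      ring
    · rw [if_pos (by omega), if_neg (by omega), if_pos (by omega), if_pos (by omega),
        if_pos (by omega)]
      ring

theorem boxRWoGG_returnProb {d : ℕ} (hd : 0 < d) (𝔡 : ℕ+ → ℕ)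
    (h𝔡 : ∀ t : ℕ, ∃ n : ℕ, t < ∑ i ∈ Finset.range n, 𝔡 i.succPNat) (t : ℕ) :
    (boxRWoGG d hd 𝔡 h𝔡).returnProb 0 t =
      hitProb (d := d) (fun s => ((boxRWoGG d hd 𝔡 h𝔡).phase s : ℕ)) 0 t 0 := by
  classical
  set D := boxRWoGG d hd 𝔡 h𝔡
  set p : ℕ → ℕ := fun s => (D.phase s : ℕ)
  have hp : Monotone p := fun s t h => D.phase_mono h
  let H : ℕ → ℕ → (Fin d → ℤ) → ℝ≥0∞ := fun k => Nat.rec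
    (fun _ => Set.indicator {0} 1)
    (fun _ F s u => ∑' w, D.step s u w * F (s + 1) w) k
  have hH : ∀ k s u, InBox (p s) u → H k s u = hitProb p s k u := by
    intro k
    induction k with
    | zero =>
      intro s u _
      change Set.indicator {0} 1 u = ((Pi.single 0 1 : (Fin d → ℤ) → ℝ≥0) u : ℝ≥0∞)
      by_cases h : u = 0 <;> simp [h]
    | succ k ih =>
      intro s u hu
      rw [hitProb, ← tsum_boxP_mul (n := D.phase s) hu]
      change ∑' w, D.step s u w * H k (s + 1) w = _
      refine tsum_congr fun w => ?_
      have hstep : D.step s u w = (boxP d (D.phase s) u w : ℝ≥0∞) :=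
        D.step_apply (show u ∈ (D.graph (D.phase s)).verts from hu) w
      rw [hstep]
      by_cases h0 : boxP d (D.phase s) u w = 0
      · simp [h0]
      · have : (boxGraph d (D.phase s)).Adj u w := by
          by_contra hc
          exact h0 (if_neg hc)
        rw [ih (s + 1) w (InBox.mono (hp (Nat.le_succ s)) this.2.1)]
  rw [D.returnProb_eq 0 t (fun s => H (t - s) s), Nat.sub_zero, hH]
  · intro i; simp
  · intro u
    rw [Nat.sub_self]
    rfl
  · intro s hs u
    rw [show t - s = (t - (s + 1)) + 1 by omega]

section Spectral

open Real

/-- The angle `π j / m`. -/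
noncomputable def gridAngle (m j : ℕ) : ℝ := π * j / m

theorem sum_cos_mul_two_sin (θ : ℝ) (N : ℕ) :
    (∑ j ∈ Finset.range N, cos (j * θ)) * (2 * sin (θ / 2)) =
      sin ((N - 1 / 2) * θ) + sin (θ / 2) := by
  induction N with
  | zero =>
    rw [show ((0 : ℕ) - 1 / 2 : ℝ) * θ = -(θ / 2) by push_cast; ring, sin_neg]
    simp
  | succ N ih =>
    rw [Finset.sum_range_succ, add_mul, ih]
    have h1 : ((N + 1 : ℕ) - 1 / 2 : ℝ) * θ = N * θ + θ / 2 := by push_cast; ring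
    have h2 : ((N : ℕ) - 1 / 2 : ℝ) * θ = N * θ - θ / 2 := by ring
    rw [h1, h2, sin_add, sin_sub]
    ring

theorem sum_cos_gridAngle {m : ℕ} (hm : 1 ≤ m) {x : ℤ} (hx : |x| ≤ m) :
    ∑ j : Fin (2 * m), cos (gridAngle m j * x) = if x = 0 then 2 * (m : ℝ) else 0 := by
  split_ifs with h
  · simp [h]
  · have hm' : (0 : ℝ) < m := by exact_mod_cast hm
    set θ : ℝ := π * x / m
    have key := sum_cos_mul_two_sin θ (2 * m)
    have e1 : (((2 * m : ℕ) : ℝ) - 1 / 2) * θ = (x : ℝ) * (2 * π) - θ / 2 := by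
      simp only [θ]
      push_cast
      field_simp
    rw [e1, sub_eq_neg_add, sin_add_int_mul_two_pi, sin_neg, neg_add_cancel] at key
    have hsin : sin (θ / 2) ≠ 0 := by
      have hxr : |(x : ℝ)| ≤ m := by exact_mod_cast hx
      rw [abs_le] at hxr
      have hx0 : (x : ℝ) ≠ 0 := by exact_mod_cast h
      rw [Ne, sin_eq_zero_iff_of_lt_of_lt]
      · simp only [θ]
        have := pi_pos.ne'
        positivity
      · simp only [θ]
        rw [div_div, lt_div_iff₀ (by positivity)]
        nlinarith [pi_pos, mul_pos pi_pos hm']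
      · simp only [θ]
        rw [div_div, div_lt_iff₀ (by positivity)]
        nlinarith [pi_pos, mul_pos pi_pos hm']
    have hz : ∑ j ∈ Finset.range (2 * m), cos (j * θ) = 0 := by
      have : 2 * sin (θ / 2) ≠ 0 := mul_ne_zero two_ne_zero hsin
      exact (mul_eq_zero.1 key).resolve_right this
    rw [← hz, Finset.sum_range]
    refine Finset.sum_congr rfl fun j _ => ?_
    congr 1
    simp only [gridAngle, θ]
    ring

theorem cos_gridAngle_stepUp_add_stepDown {m : ℕ} (hm : 1 ≤ m) (j : ℕ) {a : ℤ} (ha : |a| ≤ m) :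
    cos (gridAngle m j * stepUp m a) + cos (gridAngle m j * stepDown m a) =
      2 * cos (gridAngle m j) * cos (gridAngle m j * a) := by
  have hm' : (m : ℝ) ≠ 0 := by positivity
  have hsin : sin (gridAngle m j * m) = 0 := by
    have : gridAngle m j * m = j * π := by unfold gridAngle; field_simp
    rw [this, sin_nat_mul_pi]
  rw [abs_le] at ha
  have e1 : cos (gridAngle m j * stepUp m a) = cos (gridAngle m j * a) * cos (gridAngle m j) -
      sin (gridAngle m j * a) * sin (gridAngle m j) := by
    unfold stepUp
    split_ifs with h
    · push_cast
      rw [mul_add, mul_one, cos_add]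
    · have : a = m := by omega
      subst this
      push_cast
      rw [mul_sub, mul_one, cos_sub, hsin]
      ring
  have e2 : cos (gridAngle m j * stepDown m a) = cos (gridAngle m j * a) * cos (gridAngle m j) +
      sin (gridAngle m j * a) * sin (gridAngle m j) := by
    unfold stepDown
    split_ifs with h
    · push_cast
      rw [mul_sub, mul_one, cos_sub]
    · have : a = -m := by omega
      subst this
      push_cast
      rw [mul_add, mul_one, cos_add, mul_neg, sin_neg, hsin]
      ring
  rw [e1, e2]
  ring

/-- The eigenfunctions of the reflected walk on the box. -/
noncomputable def cosProd {d m : ℕ} (κ : Fin d → Fin (2 * m)) (x : Fin d → ℤ) : ℝ :=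
  ∏ i, cos (gridAngle m (κ i) * x i)

/-- The eigenvalues of the reflected walk on the box. -/
noncomputable def eigval {d m : ℕ} (κ : Fin d → Fin (2 * m)) : ℝ :=
  1 / d * ∑ i, cos (gridAngle m (κ i))

theorem cosProd_update {d m : ℕ} (κ : Fin d → Fin (2 * m)) (x : Fin d → ℤ) (i : Fin d) (a : ℤ) :
    cosProd κ (Function.update x i a) =
      cos (gridAngle m (κ i) * a) * ∏ j ∈ Finset.univ.erase i, cos (gridAngle m (κ j) * x j) := by
  unfold cosProd
  rw [← Finset.mul_prod_erase _ _ (Finset.mem_univ i), Function.update_self]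
  congr 1
  refine Finset.prod_congr rfl fun j hj => ?_
  rw [Function.update_of_ne (Finset.ne_of_mem_erase hj)]

theorem coordSum_cosProd {d m : ℕ} (hm : 1 ≤ m) (κ : Fin d → Fin (2 * m)) {x : Fin d → ℤ}
    (hx : InBox m x) (i : Fin d) :
    coordSum m i (cosProd κ) x = 2 * cos (gridAngle m (κ i)) * cosProd κ x := by
  have h := cosProd_update κ x i (x i)
  rw [Function.update_eq_self] at h
  unfold coordSum
  rw [cosProd_update, cosProd_update, ← add_mul, cos_gridAngle_stepUp_add_stepDown hm _ (hx i), h]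
  ring

theorem sum_coordSum_cosProd {d m : ℕ} (hm : 1 ≤ m) (κ : Fin d → Fin (2 * m)) {x : Fin d → ℤ}
    (hx : InBox m x) :
    1 / (2 * (d : ℝ)) * ∑ i, coordSum m i (cosProd κ) x = eigval κ * cosProd κ x := by
  simp only [coordSum_cosProd hm κ hx, eigval]
  rw [← Finset.sum_mul, ← Finset.mul_sum, one_div, mul_inv]
  ring

theorem sum_cosProd {d m : ℕ} (hm : 1 ≤ m) {x : Fin d → ℤ} (hx : InBox m x) :
    ∑ κ : Fin d → Fin (2 * m), cosProd κ x = if x = 0 then (2 * (m : ℝ)) ^ d else 0 := by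
  have h : ∑ κ : Fin d → Fin (2 * m), cosProd κ x =
      ∏ i, ∑ j : Fin (2 * m), cos (gridAngle m j * x i) := by
    rw [Finset.prod_univ_sum, Fintype.piFinset_univ]
    rfl
  rw [h, Finset.prod_congr rfl fun i _ => sum_cos_gridAngle hm (hx i)]
  split_ifs with h0
  · simp [h0]
  · obtain ⟨i, hi⟩ := Function.ne_iff.1 h0
    exact Finset.prod_eq_zero (Finset.mem_univ i) (if_neg hi)

/-- The spectral representation of the transition probabilities to the origin of the reflected walk
on a fixed box. -/
theorem hitProb_const_eq {d m : ℕ} (hm : 1 ≤ m) (k s : ℕ) {x : Fin d → ℤ} (hx : InBox m x) :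
    (hitProb (fun _ => m) s k x : ℝ) =
      ((2 * (m : ℝ)) ^ d)⁻¹ * ∑ κ : Fin d → Fin (2 * m), eigval κ ^ k * cosProd κ x := by
  have hm' : (2 * (m : ℝ)) ^ d ≠ 0 := by positivity
  induction k generalizing s x with
  | zero =>
    simp only [pow_zero, one_mul]
    rw [sum_cosProd hm hx, hitProb, Pi.single_apply]
    split_ifs <;> simp [hm']
  | succ k ih =>
    have hup : ∀ i, InBox m (Function.update x i (stepUp m (x i))) :=
      fun i => hx.update i (abs_stepUp_le hm (hx i))
    have hdn : ∀ i, InBox m (Function.update x i (stepDown m (x i))) :=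
      fun i => hx.update i (abs_stepDown_le hm (hx i))
    rw [hitProb, avgStep]
    push_cast
    have e : ∀ i, ((coordSum m i (hitProb (fun _ => m) (s + 1) k) x : ℝ≥0) : ℝ) =
        ((2 * (m : ℝ)) ^ d)⁻¹ * ∑ κ : Fin d → Fin (2 * m),
          eigval κ ^ k * coordSum m i (cosProd κ) x := by
      intro i
      simp only [coordSum, NNReal.coe_add, mul_add, Finset.sum_add_distrib]
      rw [ih (s + 1) (hup i), ih (s + 1) (hdn i)]
    simp only [e]
    rw [← Finset.mul_sum, Finset.sum_comm, mul_left_comm, Finset.mul_sum]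
    congr 1
    refine Finset.sum_congr rfl fun κ _ => ?_
    rw [← Finset.mul_sum, mul_left_comm, sum_coordSum_cosProd hm κ hx, pow_succ]
    ring

theorem le_hitProb_const {d m : ℕ} (hd : 0 < d) (hm : 1 ≤ m) {k : ℕ} (hk : Even k) (s : ℕ) :
    ((2 * (m : ℝ)) ^ d)⁻¹ ≤ hitProb (d := d) (fun _ => m) s k 0 := by
  have h0 : InBox m (0 : Fin d → ℤ) := fun i => by simp
  rw [hitProb_const_eq hm k s h0]
  have hd' : (d : ℝ) ≠ 0 := by positivity
  have : NeZero (2 * m) := ⟨by omega⟩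
  refine le_mul_of_one_le_right (by positivity) ?_
  have hone : ∀ κ : Fin d → Fin (2 * m), cosProd κ 0 = 1 := fun κ => by simp [cosProd]
  simp only [hone, mul_one]
  have h1 : eigval (fun _ : Fin d => (0 : Fin (2 * m))) = 1 := by
    simp [eigval, gridAngle, hd']
  calc (1 : ℝ) = eigval (fun _ : Fin d => (0 : Fin (2 * m))) ^ k := by rw [h1, one_pow]
    _ ≤ _ := Finset.single_le_sum (f := fun κ : Fin d → Fin (2 * m) => eigval κ ^ k)
      (fun κ _ => hk.pow_nonneg _) (Finset.mem_univ _)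

theorem abs_eigval_le {d m : ℕ} (hd : 0 < d) (κ : Fin d → Fin (2 * m)) :
    |eigval κ| ≤ ∏ i, exp (-(sin (gridAngle m (κ i)) ^ 2 / (2 * d))) := by
  have hd' : (0 : ℝ) < d := by exact_mod_cast hd
  have h1 : ∀ θ : ℝ, |cos θ| ≤ 1 - sin θ ^ 2 / 2 := by
    intro θ
    have hc := sin_sq_add_cos_sq θ
    rw [← sq_abs (cos θ)] at hc
    nlinarith [sq_nonneg (1 - |cos θ|)]
  rw [← Real.exp_sum]
  refine le_trans ?_ (add_one_le_exp _)
  unfold eigval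
  rw [abs_mul, abs_of_nonneg (by positivity : (0 : ℝ) ≤ 1 / d)]
  have h2 : |∑ i, cos (gridAngle m (κ i))| ≤ ∑ i, (1 - sin (gridAngle m (κ i)) ^ 2 / 2) :=
    (Finset.abs_sum_le_sum_abs _ _).trans (Finset.sum_le_sum fun i _ => h1 _)
  refine (mul_le_mul_of_nonneg_left h2 (by positivity)).trans_eq ?_
  rw [Finset.sum_sub_distrib, Finset.sum_neg_distrib, ← Finset.sum_div, ← Finset.sum_div]
  simp only [Finset.sum_const, Finset.card_univ, Fintype.card_fin, nsmul_eq_mul, mul_one]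
  field_simp
  ring

theorem two_mul_div_le_sin_gridAngle {m j : ℕ} (hm : 1 ≤ m) (hj : 2 * j ≤ m) :
    2 * (j : ℝ) / m ≤ sin (gridAngle m j) := by
  have hm' : (0 : ℝ) < m := by exact_mod_cast hm
  have hj' : 2 * (j : ℝ) ≤ m := by exact_mod_cast hj
  have h := mul_le_sin (x := gridAngle m j) (by unfold gridAngle; positivity) (by
    unfold gridAngle
    rw [div_le_div_iff₀ hm' two_pos]
    nlinarith [pi_pos])
  refine le_trans (le_of_eq ?_) h
  unfold gridAngle
  have := pi_pos.ne'
  field_simp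

/-- The bound for the one-dimensional sums in the heat kernel estimate. -/
noncomputable def thetaBound (d : ℕ) : ℝ := 4 * (1 - exp (-(2 / d : ℝ)))⁻¹

theorem sum_exp_sin_le {d m t : ℕ} (hd : 0 < d) (hm : 1 ≤ m) (ht : m ^ 2 ≤ t) :
    ∑ j : Fin (2 * m), exp (-(sin (gridAngle m j) ^ 2 / (2 * d))) ^ t ≤ thetaBound d := by
  have hd' : (0 : ℝ) < d := by exact_mod_cast hd
  have hm' : (0 : ℝ) < m := by exact_mod_cast hm
  set r : ℝ := exp (-(2 / d : ℝ)) with hr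
  have hr1 : r < 1 := by rw [hr, exp_lt_one_iff]; simpa using hd
  have hr0 : 0 < r := exp_pos _
  set F : ℕ → ℝ := fun j => exp (-(sin (gridAngle m j) ^ 2 / (2 * d))) ^ t with hF
  have hper : ∀ j, F (m + j) = F j := by
    intro j
    have : gridAngle m (m + j) = gridAngle m j + π := by
      unfold gridAngle; push_cast; field_simp; ring
    simp only [hF, this, sin_add_pi, neg_sq]
  have hsym : ∀ j ≤ m, F (m - j) = F j := by
    intro j hj
    have : gridAngle m (m - j) = π - gridAngle m j := by
      unfold gridAngle; rw [Nat.cast_sub hj]; field_simp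
    simp only [hF, this, sin_pi_sub]
  have hsmall : ∀ j, 2 * j ≤ m → F j ≤ r ^ j := by
    intro j hj
    have h1 := two_mul_div_le_sin_gridAngle hm hj
    have h2 : (2 * (j : ℝ) / m) ^ 2 ≤ sin (gridAngle m j) ^ 2 := by gcongr
    simp only [hF, hr]
    rw [← exp_nat_mul, ← exp_nat_mul, exp_le_exp]
    have h3 : (m : ℝ) ^ 2 ≤ t := by exact_mod_cast ht
    have h4 : (j : ℝ) ≤ (j : ℝ) ^ 2 := by exact_mod_cast Nat.le_self_pow two_ne_zero j
    have h5 : (j : ℝ) * (2 / d) ≤ t * (sin (gridAngle m j) ^ 2 / (2 * d)) :=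
      calc (j : ℝ) * (2 / d) ≤ (j : ℝ) ^ 2 * (2 / d) := by gcongr
        _ = (m : ℝ) ^ 2 * ((2 * (j : ℝ) / m) ^ 2 / (2 * d)) := by field_simp
        _ ≤ _ := by gcongr
    linarith
  have hall : ∀ j < m, F j ≤ r ^ j + r ^ (m - 1 - j) := by
    intro j hj
    by_cases h : 2 * j ≤ m
    · exact (hsmall j h).trans (le_add_of_nonneg_right (by positivity))
    · have h1 := hsmall (m - j) (by omega)
      rw [hsym j hj.le] at h1
      refine h1.trans (le_trans ?_ (le_add_of_nonneg_left (by positivity)))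
      exact pow_le_pow_of_le_one hr0.le hr1.le (by omega)
  have hgeo : ∑ j ∈ Finset.range m, r ^ j ≤ (1 - r)⁻¹ := by
    rw [← tsum_geometric_of_lt_one hr0.le hr1]
    exact (summable_geometric_of_lt_one hr0.le hr1).sum_le_tsum _ (fun _ _ => by positivity)
  have hhalf : ∑ j ∈ Finset.range m, F j ≤ 2 * (1 - r)⁻¹ :=
    calc ∑ j ∈ Finset.range m, F j ≤ ∑ j ∈ Finset.range m, (r ^ j + r ^ (m - 1 - j)) :=
          Finset.sum_le_sum fun j hj => hall j (Finset.mem_range.1 hj)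
      _ = ∑ j ∈ Finset.range m, r ^ j + ∑ j ∈ Finset.range m, r ^ j := by
          rw [Finset.sum_add_distrib, Finset.sum_range_reflect (fun j => r ^ j) m]
      _ ≤ _ := by linarith
  calc ∑ j : Fin (2 * m), F j = ∑ j ∈ Finset.range (m + m), F j := by
        rw [← two_mul, Finset.sum_range]
    _ = ∑ j ∈ Finset.range m, F j + ∑ j ∈ Finset.range m, F j := by
        rw [Finset.sum_range_add]
        simp only [hper]
    _ ≤ thetaBound d := by unfold thetaBound; linarith

theorem hitProb_const_le_pow {d m t : ℕ} (hd : 0 < d) (hm : 1 ≤ m) (ht : m ^ 2 ≤ t) (s : ℕ)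
    {x : Fin d → ℤ} (hx : InBox m x) :
    (hitProb (fun _ => m) s t x : ℝ) ≤ (thetaBound d / (2 * m)) ^ d := by
  rw [hitProb_const_eq hm t s hx, div_pow, div_eq_inv_mul]
  have hcos : ∀ κ : Fin d → Fin (2 * m), |cosProd κ x| ≤ 1 := by
    intro κ
    unfold cosProd
    rw [Finset.abs_prod]
    exact Finset.prod_le_one (fun _ _ => abs_nonneg _) (fun _ _ => abs_cos_le_one _)
  refine mul_le_mul_of_nonneg_left ?_ (by positivity)
  calc ∑ κ : Fin d → Fin (2 * m), eigval κ ^ t * cosProd κ x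
      ≤ ∑ κ : Fin d → Fin (2 * m), ∏ i, exp (-(sin (gridAngle m (κ i)) ^ 2 / (2 * d))) ^ t := by
        refine Finset.sum_le_sum fun κ _ => (le_abs_self _).trans ?_
        rw [abs_mul, abs_pow, Finset.prod_pow]
        calc |eigval κ| ^ t * |cosProd κ x| ≤ |eigval κ| ^ t * 1 := by gcongr; exact hcos κ
          _ ≤ _ := by rw [mul_one]; gcongr; exact abs_eigval_le hd κ
    _ = ∏ _i : Fin d, ∑ j : Fin (2 * m), exp (-(sin (gridAngle m j) ^ 2 / (2 * d))) ^ t := by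
        rw [Finset.prod_univ_sum, Fintype.piFinset_univ]
    _ ≤ ∏ _i : Fin d, thetaBound d :=
        Finset.prod_le_prod (fun _ _ => Finset.sum_nonneg fun _ _ => by positivity)
          (fun _ _ => sum_exp_sin_le hd hm ht)
    _ = thetaBound d ^ d := by simp

end Spectral

theorem exists_hitProb_le {d : ℕ} (hd : 0 < d) : ∃ K : ℝ≥0, ∀ p : ℕ → ℕ, Monotone p →
    (∀ s, 1 ≤ p s) → ∀ m t : ℕ, 1 ≤ m → m ^ 2 ≤ t → m ≤ p (t - m ^ 2) →
      hitProb (d := d) p 0 t 0 ≤ K * ((m : ℝ≥0) ^ d)⁻¹ := by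
  refine ⟨((thetaBound d / 2) ^ d).toNNReal, fun p hp h1 m t hm hmt hpm => ?_⟩
  have h := hitProb_le_of_forall (d := d) hd hp h1 (k := m ^ 2)
    (c := ((thetaBound d / 2) ^ d).toNNReal * ((m : ℝ≥0) ^ d)⁻¹) (t - m ^ 2) 0 ?_
    (x := 0) (fun i => by simp)
  · rwa [Nat.sub_add_cancel hmt] at h
  · intro x hx
    rw [zero_add] at hx ⊢
    obtain ⟨y, hy, hxy⟩ := (hitProb_unimodal hp h1 (t - m ^ 2) (m ^ 2)).exists_le_apply hx
    refine hxy.trans ((hitProb_le_const hm hp h1 (m ^ 2) _ hpm (hy.mono hm) 0).trans ?_)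
    rw [← NNReal.coe_le_coe]
    refine (hitProb_const_le_pow hd hm le_rfl 0 (hy.mono hm)).trans ?_
    push_cast
    rw [← div_div, div_pow, div_eq_mul_inv]
    gcongr
    exact Real.le_coe_toNNReal _

theorem le_hitProb {d : ℕ} (hd : 0 < d) {p : ℕ → ℕ} (hp : Monotone p) (h1 : ∀ s, 1 ≤ p s) {t : ℕ}
    (ht : Even t) : ((2 * (p t : ℝ≥0)) ^ d)⁻¹ ≤ hitProb (d := d) p 0 t 0 := by
  have h := hitProb_const_le (d := d) (n := p t) hp h1 t 0
    (fun j hj => hp (by omega)) (x := 0) (fun i => by simp) 0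
  refine le_trans ?_ h
  rw [← NNReal.coe_le_coe]
  push_cast
  exact le_hitProb_const hd (h1 t) ht 0

theorem tsum_le_two_mul_tsum_even {f : ℕ → ℝ≥0∞} (hf : Antitone f) :
    ∑' t, f t ≤ 2 * ∑' t, f (2 * t) := by
  rw [← tsum_even_add_odd (f := f) ENNReal.summable ENNReal.summable, two_mul]
  gcongr with t
  exact hf (Nat.le_succ _)

theorem tsum_ne_top_of_even_bound {f R : ℕ → ℝ≥0∞} (hf : Antitone f) {C : ℝ≥0∞} (hC : C ≠ ∞)
    (hR : ∀ t, f (2 * t) ≤ C * R (2 * t)) (h0 : R 0 ≠ ∞) (h : ∑' t, R (t + 1) ≠ ∞) :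
    ∑' t, f t ≠ ∞ := by
  have hsum : ∑' t, R t ≠ ∞ := by
    rw [tsum_eq_zero_add' ENNReal.summable]
    exact ENNReal.add_ne_top.2 ⟨h0, h⟩
  have heven : ∑' t, R (2 * t) ≠ ∞ := ne_top_of_le_ne_top hsum
    (ENNReal.tsum_comp_le_tsum_of_injective (mul_right_injective₀ two_ne_zero) R)
  refine ne_top_of_le_ne_top ?_ (tsum_le_two_mul_tsum_even hf)
  refine ENNReal.mul_ne_top (by simp) (ne_top_of_le_ne_top ?_ (ENNReal.tsum_le_tsum hR))
  rw [ENNReal.tsum_mul_left]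
  exact ENNReal.mul_ne_top hC heven

/-- The times at which a growing sequence is at least `a` but was not `l` steps earlier. -/
def recentlyAbove (p : ℕ → ℕ) (a l : ℕ) : Set ℕ := {t | a ≤ p t ∧ (t < l ∨ p (t - l) < a)}

theorem encard_recentlyAbove_le {p : ℕ → ℕ} (hp : Monotone p) (a l : ℕ) :
    (recentlyAbove p a l).encard ≤ l := by
  classical
  by_cases h : ∃ t, a ≤ p t
  · have hsub : recentlyAbove p a l ⊆ ↑(Finset.Ico (Nat.find h) (Nat.find h + l)) := by
      rintro t ⟨h1, h2⟩
      rw [Finset.mem_coe, Finset.mem_Ico]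
      refine ⟨Nat.find_min' h h1, ?_⟩
      by_contra hlt
      have h3 : p (Nat.find h) ≤ p (t - l) := hp (by omega)
      have h4 := Nat.find_spec h
      omega
    refine (Set.encard_le_encard hsub).trans_eq ?_
    rw [Set.encard_coe_eq_coe_finsetCard, Nat.card_Ico, Nat.add_sub_cancel_left]
  · have : recentlyAbove p a l = ∅ := by
      ext t
      simp only [Set.mem_empty_iff_false, iff_false]
      exact fun ht => h ⟨t, ht.1⟩
    simp [this]

theorem exists_dyadic_scale {p : ℕ → ℕ} (h1 : ∀ s, 1 ≤ p s) {t : ℕ} (ht : 1 ≤ t) :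
    ∃ i, (4 ^ i ≤ t ∧ 2 ^ i ≤ p (t - 4 ^ i)) ∧
      ¬(4 ^ (i + 1) ≤ t ∧ 2 ^ (i + 1) ≤ p (t - 4 ^ (i + 1))) := by
  by_contra! hc
  have : ∀ i, 4 ^ i ≤ t ∧ 2 ^ i ≤ p (t - 4 ^ i) := by
    intro i
    induction i with
    | zero => exact ⟨by simpa using ht, by simpa using h1 _⟩
    | succ i ih => exact hc i ih
  exact absurd (this t).1 (not_le.2 (Nat.lt_pow_self (by norm_num)))

theorem le_of_scale_bound {d : ℕ} {K : ℝ≥0∞} {R : ℕ → ℝ≥0∞} {p : ℕ → ℕ} (h1 : ∀ s, 1 ≤ p s)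
    (hR : ∀ m t : ℕ, 1 ≤ m → m ^ 2 ≤ t → m ≤ p (t - m ^ 2) → R t ≤ K * ((m : ℝ≥0∞) ^ d)⁻¹)
    {t : ℕ} (ht : 1 ≤ t) :
    R t ≤ K * 2 ^ d * ((p t : ℝ≥0∞) ^ d)⁻¹ +
      ∑' j : ℕ, (recentlyAbove p (2 ^ j) (4 ^ j)).indicator
        (fun _ => K * 2 ^ d * (((2 : ℝ≥0∞) ^ j) ^ d)⁻¹) t := by
  obtain ⟨i, ⟨h4, h2⟩, hn⟩ := exists_dyadic_scale h1 ht
  have hsq : (2 ^ i) ^ 2 = 4 ^ i := by rw [← pow_mul, mul_comm, pow_mul]; norm_num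
  have hb := hR (2 ^ i) t Nat.one_le_two_pow (by rwa [hsq]) (by rwa [hsq])
  have e : K * (((2 ^ i : ℕ) : ℝ≥0∞) ^ d)⁻¹ =
      K * 2 ^ d * (((2 : ℝ≥0∞) ^ (i + 1)) ^ d)⁻¹ := by
    rw [pow_succ', mul_pow, ENNReal.mul_inv (by simp) (by simp), mul_assoc, ← mul_assoc (2 ^ d),
      ENNReal.mul_inv_cancel (by simp) (by simp), one_mul]
    push_cast
    rfl
  rw [e] at hb
  refine hb.trans ?_
  by_cases hp : 2 ^ (i + 1) ≤ p t
  · refine le_trans ?_ le_add_self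
    refine le_trans ?_ (ENNReal.le_tsum (i + 1))
    rw [Set.indicator_of_mem]
    refine ⟨hp, ?_⟩
    by_contra! hc
    exact hn hc
  · refine le_trans ?_ le_self_add
    gcongr
    exact_mod_cast (not_le.1 hp).le

theorem tsum_ne_top_of_scale_bound {d : ℕ} (hd : 3 ≤ d) {K : ℝ≥0∞} (hK : K ≠ ∞) {R : ℕ → ℝ≥0∞}
    {p : ℕ → ℕ} (hp : Monotone p) (h1 : ∀ s, 1 ≤ p s)
    (hR : ∀ m t : ℕ, 1 ≤ m → m ^ 2 ≤ t → m ≤ p (t - m ^ 2) → R t ≤ K * ((m : ℝ≥0∞) ^ d)⁻¹)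
    (hS : ∑' t, ((p t : ℝ≥0∞) ^ d)⁻¹ ≠ ∞) : ∑' t, R (t + 1) ≠ ∞ := by
  have hK2 : K * 2 ^ d ≠ ∞ := ENNReal.mul_ne_top hK (by simp)
  set F : ℕ → ℕ → ℝ≥0∞ := fun j => (recentlyAbove p (2 ^ j) (4 ^ j)).indicator
    (fun _ => K * 2 ^ d * (((2 : ℝ≥0∞) ^ j) ^ d)⁻¹) with hF
  have hFj : ∀ j, ∑' t, F j t ≤ K * 2 ^ d * 2⁻¹ ^ j := by
    intro j
    rw [← tsum_subtype, ENNReal.tsum_const, mul_comm, mul_assoc]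
    gcongr
    have hc : ((ENat.card (recentlyAbove p (2 ^ j) (4 ^ j)) : ℕ∞) : ℝ≥0∞) ≤ 4 ^ j := by
      have := encard_recentlyAbove_le hp (2 ^ j) (4 ^ j)
      have h' : (((recentlyAbove p (2 ^ j) (4 ^ j)).encard : ℕ∞) : ℝ≥0∞) ≤
          (((4 ^ j : ℕ) : ℕ∞) : ℝ≥0∞) := ENat.toENNReal_le.2 this
      simpa using h'
    have h8 : ((2 : ℝ≥0∞) ^ j) ^ 3 ≤ ((2 : ℝ≥0∞) ^ j) ^ d :=
      pow_le_pow_right₀ (one_le_pow₀ (by norm_num)) hd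
    calc (((2 : ℝ≥0∞) ^ j) ^ d)⁻¹ * _ ≤ (((2 : ℝ≥0∞) ^ j) ^ 3)⁻¹ * 4 ^ j :=
          mul_le_mul' (ENNReal.inv_le_inv.2 h8) hc
      _ = 2⁻¹ ^ j := by
          have h4 : (4 : ℝ≥0∞) ^ j = (2 ^ j) ^ 2 := by
            rw [← pow_mul, mul_comm, pow_mul]; norm_num
          rw [h4, pow_succ' _ 2, ENNReal.mul_inv (by simp) (by simp), mul_assoc,
            ENNReal.inv_mul_cancel (by simp) (by simp), mul_one, ENNReal.inv_pow]
  have hFsum : ∑' t, ∑' j, F j t ≠ ∞ := by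
    rw [ENNReal.tsum_comm]
    refine ne_top_of_le_ne_top ?_ (ENNReal.tsum_le_tsum hFj)
    rw [ENNReal.tsum_mul_left, ENNReal.tsum_geometric]
    refine ENNReal.mul_ne_top hK2 ?_
    simp
  have hle : ∑' t, R (t + 1) ≤
      ∑' t, (K * 2 ^ d * ((p t : ℝ≥0∞) ^ d)⁻¹ + ∑' j, F j t) := by
    refine (ENNReal.tsum_le_tsum fun t => le_of_scale_bound h1 hR (Nat.le_add_left 1 t)).trans ?_
    exact ENNReal.tsum_comp_le_tsum_of_injective (add_left_injective 1)
      fun t => K * 2 ^ d * ((p t : ℝ≥0∞) ^ d)⁻¹ + ∑' j, F j t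
  refine ne_top_of_le_ne_top ?_ hle
  rw [ENNReal.tsum_add, ENNReal.tsum_mul_left]
  exact ENNReal.add_ne_top.2 ⟨ENNReal.mul_ne_top hK2 hS, hFsum⟩

theorem tsum_returnProb_succ_ne_top_iff (d : ℕ) (hd : 3 ≤ d) (𝔡 : ℕ+ → ℕ)
    (h𝔡 : ∀ t : ℕ, ∃ n : ℕ, t < ∑ i ∈ Finset.range n, 𝔡 i.succPNat) :
    ∑' t, (boxRWoGG d (by omega) 𝔡 h𝔡).returnProb 0 (t + 1) ≠ ∞ ↔
      ∑' n : ℕ+, (𝔡 n : ℝ≥0∞) / (n : ℝ≥0∞) ^ d ≠ ∞ := by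
  have hd0 : 0 < d := by omega
  set D := boxRWoGG d hd0 𝔡 h𝔡
  set p : ℕ → ℕ := fun s => (D.phase s : ℕ) with hpdef
  have hp : Monotone p := fun s t h => D.phase_mono h
  have h1 : ∀ s, 1 ≤ p s := fun s => (D.phase s).pos
  have hret : ∀ t, D.returnProb 0 t = hitProb (d := d) p 0 t 0 :=
    boxRWoGG_returnProb hd0 𝔡 h𝔡
  have hS : ∑' n : ℕ+, (𝔡 n : ℝ≥0∞) / (n : ℝ≥0∞) ^ d = ∑' t, ((p t : ℝ≥0∞) ^ d)⁻¹ :=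
    (D.tsum_phase fun n => ((n : ℝ≥0∞) ^ d)⁻¹).symm
  rw [hS]
  constructor
  · intro h
    have hanti : Antitone fun t => ((p t : ℝ≥0∞) ^ d)⁻¹ := by
      intro s t hst
      have := hp hst
      simp only
      gcongr
    have htwo : ∀ t, ((p (2 * t) : ℝ≥0∞) ^ d)⁻¹ ≤ 2 ^ d * D.returnProb 0 (2 * t) := by
      intro t
      have hl := le_hitProb hd0 hp h1 (even_two_mul t)
      have hp0 : ((p (2 * t) : ℝ≥0)) ≠ 0 := by
        have := h1 (2 * t)
        positivity
      have hl' : ((p (2 * t) : ℝ≥0) ^ d)⁻¹ ≤ 2 ^ d * hitProb (d := d) p 0 (2 * t) 0 := by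
        refine le_trans (le_of_eq ?_) (mul_le_mul_right hl (2 ^ d))
        rw [mul_pow, mul_inv, mul_inv_cancel_left₀ (by positivity)]
      rw [hret]
      have := ENNReal.coe_le_coe.2 hl'
      rw [ENNReal.coe_inv (by positivity)] at this
      push_cast at this
      exact this
    exact tsum_ne_top_of_even_bound hanti (by simp) htwo (by rw [hret]; exact ENNReal.coe_ne_top) h
  · intro h
    obtain ⟨K, hK⟩ := exists_hitProb_le hd0
    refine tsum_ne_top_of_scale_bound hd (K := K) ENNReal.coe_ne_top hp h1
      (fun m t hm hmt hpm => ?_) h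
    have := ENNReal.coe_le_coe.2 (hK p hp h1 m t hm hmt hpm)
    rw [ENNReal.coe_mul, ENNReal.coe_inv (by positivity)] at this
    push_cast at this
    rw [hret]
    exact this

theorem theorem5p2 (d : ℕ) (hd : 4 ≤ d) (𝔡 : ℕ+ → ℕ)
    (h𝔡 : ∀ t : ℕ, ∃ n : ℕ, t < ∑ i ∈ Finset.range n, 𝔡 i.succPNat) :
    ((boxRWoGG d (by omega) 𝔡 h𝔡).IsRecurrent 0 ↔
        ∑' n : ℕ+, (𝔡 n : ℝ≥0∞) / (n : ℝ≥0∞) ^ d = ∞) ∧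
      ((boxRWoGG d (by omega) 𝔡 h𝔡).IsTransient 0 ↔
        ∑' n : ℕ+, (𝔡 n : ℝ≥0∞) / (n : ℝ≥0∞) ^ d < ∞) := by
  have h := tsum_returnProb_succ_ne_top_iff d (by omega) 𝔡 h𝔡
  refine ⟨not_iff_not.1 h, ?_⟩
  rw [RWoGG.IsTransient, lt_top_iff_ne_top, lt_top_iff_ne_top, ← h,
    tsum_eq_zero_add' ENNReal.summable, ENNReal.add_ne_top]
  exact and_iff_right (MeasureTheory.measure_ne_top _ _)
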